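/- Let $H\in(0,1/2)$ and $\alpha\in[0,2H)$. There exists a constant $C_{\alpha,H}\in(0,\infty)$, depending only on $\alpha$ and $H$, such that the following holds. Let $(\beta^H(t))_{t\ge 0}$ be a real-valued fractional Brownian motion with Hurst index $H$ on a probability space, i.e. a Gaussian process with almost surely continuous paths such that $\mathbb{E}[\beta^H(t)]=0$ and $\mathbb{E}[\beta^H(t)\beta^H(s)]=\frac12\bigl(t^{2H}+s^{2H}-|t-s|^{2H}\bigr)$ for all $s,t\ge 0$. For $\lambda>0$, let $$\mathcal{Z}^{H,\lambda}(t)=\int_0^t e^{-\lambda(t-s)}\,d\beta^H(s),\qquad t\ge 0,$$ be the fractional Ornstein--Uhlenbeck process, where for $\phi$ of class $\mathcal{C}^1$ the integral is defined by $\int_0^T\phi(s)\,d\beta^H(s)=\phi(T)\beta^H(T)-\int_0^T\phi'(s)\beta^H(s)\,ds$. For $\Delta t\in(0,1)$ set $t_n=n\Delta t$, $\mathcal{Z}^{H,\lambda}_0=0$ and $$\mathcal{Z}^{H,\lambda}_{n+1}=e^{-\lambda\Delta t}\bigl(\mathcal{Z}^{H,\lambda}_n+\beta^H(t_{n+1})-\beta^H(t_n)\bigr),\qquad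 n\ge 0.$$ Then, for all $\lambda\in(0,\infty)$ and all $\Delta t\in(0,1)$, the errors $\mathcal{Z}^{H,\lambda}(t_n)-\mathcal{Z}^{H,\lambda}_n$, $n\ge 0$, are square integrable and $$\sup_{n\ge 0}\ \mathbb{E}\bigl[|\mathcal{Z}^{H,\lambda}(t_n)-\mathcal{Z}^{H,\lambda}_n|^2\bigr]\le C_{\alpha,H}\,\lambda^{-2H}(\lambda\Delta t)^{2\alpha}.$$ -/

import Mathlib

open MeasureTheory ProbabilityTheory
open scoped NNReal

/-- `β` is a real-valued fractional Brownian motion with Hurst index `H`: a centred Gaussian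
process with covariance `(t ^ (2H) + s ^ (2H) - |t - s| ^ (2H)) / 2`, with almost surely
continuous paths. -/
structure IsFractionalBrownianMotion {Ω : Type*} {mΩ : MeasurableSpace Ω} (H : ℝ)
    (β : ℝ≥0 → Ω → ℝ) (P : Measure Ω) : Prop where
  isGaussianProcess : IsGaussianProcess β P
  mean_eq_zero : ∀ t : ℝ≥0, ∫ ω, β t ω ∂P = 0
  covariance_eq : ∀ t s : ℝ≥0, ∫ ω, β t ω * β s ω ∂P =
    (1 / 2) * ((t : ℝ) ^ (2 * H) + (s : ℝ) ^ (2 * H) - |(t : ℝ) - (s : ℝ)| ^ (2 * H))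
  ae_continuous : ∀ᵐ ω ∂P, Continuous fun t : ℝ≥0 => β t ω

/-- The stochastic integral `∫_0^T φ(s) dβ(s)` of a deterministic integrand `φ` of class `C¹`,
defined by integration by parts: `φ(T) β(T) - ∫_0^T φ'(s) β(s) ds`. -/
noncomputable def fbmIntegral {Ω : Type*} (β : ℝ≥0 → Ω → ℝ) (φ : ℝ → ℝ) (T : ℝ≥0) (ω : Ω) : ℝ :=
  φ T * β T ω - ∫ s in (0 : ℝ)..T, deriv φ s * β s.toNNReal ω

/-- The fractional Ornstein-Uhlenbeck process `Z(t) = ∫_0^t exp(-lam (t - s)) dβ(s)`. -/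
noncomputable def fractionalOU {Ω : Type*} (β : ℝ≥0 → Ω → ℝ) (lam : ℝ) (t : ℝ≥0) : Ω → ℝ :=
  fbmIntegral β (fun s => Real.exp (-lam * ((t : ℝ) - s))) t

/-- The discrete scheme `Z_0 = 0`, `Z_{n+1} = exp(-lam dt) (Z_n + (β(t_{n+1}) - β(t_n)))` with
`t_n = n dt`. -/
noncomputable def schemeOU {Ω : Type*} (β : ℝ≥0 → Ω → ℝ) (lam : ℝ) (dt : ℝ≥0) : ℕ → Ω → ℝ
  | 0 => fun _ => 0
  | n + 1 => fun ω => Real.exp (-lam * dt) *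
      (schemeOU β lam dt n ω + (β (((n + 1 : ℕ) : ℝ≥0) * dt) ω - β ((n : ℝ≥0) * dt) ω))

open Filter Topology

/-! Put `q = exp (-lam * dt)`. Integration by parts shows that the error at `t_n` satisfies `E_{n+1}
= q E_n + V_n`, where `V_n` is the integral over the `n`-th step of `lam * exp (-lam * (t_{n+1} -
s))` times `β(t_{n+1}) - β(s)`. The weights are nonnegative with total mass `1 - q`.

For `H ≤ 1/2` increments over disjoint intervals are nonpositively correlated, because `x ^ (2H)` is
concave. Hence `V_n` is nonpositively correlated with `E_n`, and the cross term can be dropped.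
Weighted Cauchy-Schwarz bounds the second moment of `V_n` by `(1 - q) * lam ^ (-2H)` times the
integral of `exp (-v) * v ^ (2H)` over `[0, lam * dt]`, which is at most `2 * (lam * dt) ^ δ`
whenever `0 ≤ δ ≤ 2H + 1`. The resulting bound `(1 - q) B` is preserved by the recursion since `q² B
+ (1 - q) B ≤ B`, so the estimate is uniform in `n`.

Second moments are computed only for finite Riemann sums (`globalErrorSum_bound`). These converge
almost surely to the error (`tendsto_globalErrorSum`), and Fatou's lemma transfers the bound
(`memLp_two_of_tendsto_ae`). -/

/-! ### Concavity of powers and Riemann sums with exponential weights -/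

/-- The points `y + u` and `y + v` are convex combinations of `y` and `y + u + v` with swapped
weights; adding the two concavity inequalities gives the claim. -/
lemma rpow_add_add_rpow_le {γ y u v : ℝ} (hγ0 : 0 ≤ γ) (hγ1 : γ ≤ 1)
    (hy : 0 ≤ y) (hu : 0 ≤ u) (hv : 0 ≤ v) :
    (y + u + v) ^ γ + y ^ γ ≤ (y + u) ^ γ + (y + v) ^ γ := by
  rcases (add_nonneg hu hv).eq_or_lt with h | h
  · have hu' : u = 0 := by linarith
    have hv' : v = 0 := by linarith
    simp [hu', hv']
  have hc := Real.concaveOn_rpow hγ0 hγ1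
  have hz : y + u + v ∈ Set.Ici (0 : ℝ) := by simp only [Set.mem_Ici]; positivity
  have hsum : v / (u + v) + u / (u + v) = 1 := by field_simp; ring
  have h1 := hc.2 (Set.mem_Ici.2 hy) hz
    (div_nonneg hv h.le) (div_nonneg hu h.le) hsum
  have h2 := hc.2 (Set.mem_Ici.2 hy) hz
    (div_nonneg hu h.le) (div_nonneg hv h.le) (by rw [add_comm]; exact hsum)
  have e1 : v / (u + v) * y + u / (u + v) * (y + u + v) = y + u := by field_simp; ring
  have e2 : u / (u + v) * y + v / (u + v) * (y + u + v) = y + v := by field_simp; ring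
  simp only [smul_eq_mul, e1, e2] at h1 h2
  have e3 : (y + u + v) ^ γ + y ^ γ = (v / (u + v) + u / (u + v)) * ((y + u + v) ^ γ + y ^ γ) := by
    rw [hsum, one_mul]
  rw [e3]
  linarith

/-- Discrete form of the fact that `-(2 + v) * exp (-v)` is a primitive of `(1 + v) * exp (-v)`; the
right side telescopes along a partition. -/
lemma exp_neg_sub_mul_le {a b : ℝ} :
    (Real.exp (-b) - Real.exp (-a)) * (1 + b) ≤
      (2 + b) * Real.exp (-b) - (2 + a) * Real.exp (-a) := by
  have h := Real.add_one_le_exp (a - b)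
  have h2 : Real.exp (a - b) * Real.exp (-a) = Real.exp (-b) := by rw [← Real.exp_add]; ring_nf
  nlinarith [Real.exp_pos (-a)]

lemma sum_exp_neg_mul_rpow_le_two {γ : ℝ} (hγ0 : 0 ≤ γ) (hγ1 : γ ≤ 1) {v : ℕ → ℝ}
    (hv : Antitone v) {M : ℕ} (hM : v M = 0) :
    ∑ i ∈ Finset.range M, (Real.exp (-v (i + 1)) - Real.exp (-v i)) * v (i + 1) ^ γ ≤ 2 := by
  have h0 : ∀ i ≤ M, 0 ≤ v i := fun i hi => hM ▸ hv hi
  calc _ ≤ ∑ i ∈ Finset.range M, ((2 + v (i + 1)) * Real.exp (-v (i + 1))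
          - (2 + v i) * Real.exp (-v i)) := by
        refine Finset.sum_le_sum fun i hi => le_trans ?_ exp_neg_sub_mul_le
        have hvi := h0 (i + 1) (Finset.mem_range.1 hi)
        refine mul_le_mul_of_nonneg_left ?_ (sub_nonneg.2 (Real.exp_le_exp.2
          (neg_le_neg (hv i.le_succ))))
        -- In both cases `v ^ γ ≤ 1 + v`.
        rcases le_total (v (i + 1)) 1 with h | h
        · linarith [Real.rpow_le_one hvi h hγ0]
        · linarith [(Real.rpow_le_rpow_of_exponent_le h hγ1).trans_eq (Real.rpow_one _)]
    _ = 2 - (2 + v 0) * Real.exp (-v 0) := by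
        rw [Finset.sum_range_sub fun i => (2 + v i) * Real.exp (-v i), hM]; simp
    _ ≤ 2 := by
        have := h0 0 (Nat.zero_le _)
        have : 0 ≤ (2 + v 0) * Real.exp (-v 0) := by positivity
        linarith

lemma sum_exp_neg_mul_rpow_le {γ : ℝ} (hγ0 : 0 ≤ γ) {v : ℕ → ℝ}
    (hv : Antitone v) {M : ℕ} (hM : v M = 0) :
    ∑ i ∈ Finset.range M, (Real.exp (-v (i + 1)) - Real.exp (-v i)) * v (i + 1) ^ γ ≤
      (1 - Real.exp (-v 0)) * v 0 ^ γ := by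
  have h0 : ∀ i ≤ M, 0 ≤ v i := fun i hi => hM ▸ hv hi
  calc _ ≤ ∑ i ∈ Finset.range M, (Real.exp (-v (i + 1)) - Real.exp (-v i)) * v 0 ^ γ := by
        refine Finset.sum_le_sum fun i hi => mul_le_mul_of_nonneg_left ?_ (sub_nonneg.2
          (Real.exp_le_exp.2 (neg_le_neg (hv i.le_succ))))
        exact Real.rpow_le_rpow (h0 _ (Finset.mem_range.1 hi)) (hv (Nat.zero_le _)) hγ0
    _ = _ := by
        rw [← Finset.sum_mul, Finset.sum_range_sub fun i => Real.exp (-v i), hM]; simp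

/-- Below `v 0 = 1` the crude bound of order `v 0 ^ (γ + 1)` is the sharper one; above, the uniform
bound `2` suffices. Together they allow every exponent between `0` and `γ + 1`. -/
lemma sum_exp_neg_mul_rpow_le_two_mul_rpow {γ δ : ℝ} (hγ0 : 0 ≤ γ) (hγ1 : γ ≤ 1) (hδ0 : 0 ≤ δ)
    (hδ : δ ≤ γ + 1) {v : ℕ → ℝ} (hv : Antitone v) {M : ℕ} (hM : v M = 0) (hv0 : 0 < v 0) :
    ∑ i ∈ Finset.range M, (Real.exp (-v (i + 1)) - Real.exp (-v i)) * v (i + 1) ^ γ ≤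
      2 * v 0 ^ δ := by
  rcases le_total (v 0) 1 with h | h
  · calc _ ≤ (1 - Real.exp (-v 0)) * v 0 ^ γ := sum_exp_neg_mul_rpow_le hγ0 hv hM
      _ ≤ v 0 * v 0 ^ γ := by
          gcongr
          linarith [Real.add_one_le_exp (-v 0)]
      _ = v 0 ^ (γ + 1) := by rw [Real.rpow_add_one hv0.ne', mul_comm]
      _ ≤ v 0 ^ δ := Real.rpow_le_rpow_of_exponent_ge hv0 h hδ
      _ ≤ 2 * v 0 ^ δ := by linarith [Real.rpow_nonneg hv0.le δ]
  · refine (sum_exp_neg_mul_rpow_le_two hγ0 hγ1 hv hM).trans ?_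
    linarith [Real.one_le_rpow h hδ0]

/-- Convergence of the Riemann sums with exact weights along equidistant partitions. -/
lemma tendsto_sum_sub_mul_integral {W w F : ℝ → ℝ} (hW : ∀ s, HasDerivAt W (w s) s)
    (hw : Continuous w) (hF : Continuous F) {a b : ℝ} (hab : a ≤ b) :
    Tendsto (fun m : ℕ => ∑ i ∈ Finset.range (m + 1),
      (W (a + (b - a) * (((i + 1 : ℕ) : ℝ) / (m + 1))) - W (a + (b - a) * ((i : ℝ) / (m + 1)))) *
        F (a + (b - a) * (((i + 1 : ℕ) : ℝ) / (m + 1)))) atTop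
      (𝓝 (∫ s in a..b, w s * F s)) := by
  have hunif := isCompact_Icc (a := a) (b := b) |>.uniformContinuousOn_of_continuous hF.continuousOn
  obtain ⟨B, hB⟩ := (isCompact_Icc (a := a) (b := b)).exists_bound_of_continuousOn hw.continuousOn
  have hB0 : 0 ≤ B := (norm_nonneg _).trans (hB a ⟨le_rfl, hab⟩)
  rw [Metric.tendsto_atTop]
  intro ε hε
  -- The total error will be at most `B * (b - a) * η`; the `+ 1` keeps the denominator positive and
  -- the final inequality strict.
  set η : ℝ := ε / (B * (b - a) + 1) with hη
  have hden : 0 < B * (b - a) + 1 := by have := sub_nonneg.2 hab; positivity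
  have hη0 : 0 < η := by positivity
  obtain ⟨δ, hδ, hFδ⟩ := Metric.uniformContinuousOn_iff.1 hunif η hη0
  obtain ⟨N, hN⟩ := exists_nat_gt ((b - a) / δ)
  refine ⟨N, fun m hm => ?_⟩
  have hm0 : (0 : ℝ) < m + 1 := by positivity
  set s : ℕ → ℝ := fun i => a + (b - a) * ((i : ℝ) / (m + 1)) with hs
  have hs0 : s 0 = a := by simp [hs]
  have hsM : s (m + 1) = b := by simp only [hs]; push_cast; field_simp; ring
  have hstep : ∀ i, s (i + 1) - s i = (b - a) / (m + 1) := by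
    intro i; simp only [hs]; push_cast; field_simp; ring
  have hmono : Monotone s := monotone_nat_of_le_succ fun i => by
    have := hstep i
    have h2 : 0 ≤ (b - a) / ((m : ℝ) + 1) := div_nonneg (sub_nonneg.2 hab) hm0.le
    linarith
  have hmesh : (b - a) / ((m : ℝ) + 1) < δ := by
    rw [div_lt_iff₀ hδ] at hN
    rw [div_lt_iff₀ hm0]
    have : (N : ℝ) ≤ m := by exact_mod_cast hm
    nlinarith
  have hcont : Continuous fun r => w r * F r := hw.mul hF
  have hint : ∫ r in a..b, w r * F r =
      ∑ i ∈ Finset.range (m + 1), ∫ r in (s i)..(s (i + 1)), w r * F r := by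
    rw [intervalIntegral.sum_integral_adjacent_intervals
      fun k _ => hcont.intervalIntegrable _ _, hs0, hsM]
  have hterm : ∀ i, (W (s (i + 1)) - W (s i)) * F (s (i + 1)) =
      ∫ r in (s i)..(s (i + 1)), w r * F (s (i + 1)) := by
    intro i
    rw [intervalIntegral.integral_mul_const, intervalIntegral.integral_eq_sub_of_hasDerivAt
      (fun r _ => hW r) (hw.intervalIntegrable _ _)]
  change dist (∑ i ∈ Finset.range (m + 1), (W (s (i + 1)) - W (s i)) * F (s (i + 1))) _ < ε
  rw [hint, dist_eq_norm, ← Finset.sum_sub_distrib]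
  have hle : ∀ i ∈ Finset.range (m + 1),
      ‖(W (s (i + 1)) - W (s i)) * F (s (i + 1)) - ∫ r in (s i)..(s (i + 1)), w r * F r‖ ≤
        B * η * (s (i + 1) - s i) := by
    intro i hi
    have hc : Continuous fun r => w r * F (s (i + 1)) := hw.mul continuous_const
    rw [hterm, ← intervalIntegral.integral_sub
      (hc.intervalIntegrable _ _) (hcont.intervalIntegrable _ _)]
    have hle' := hmono i.le_succ
    refine (intervalIntegral.norm_integral_le_of_norm_le_const (C := B * η) ?_).trans_eq
      (by rw [abs_of_nonneg (sub_nonneg.2 hle')])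
    intro r hr
    rw [Set.uIoc_of_le hle'] at hr
    have hlow : a ≤ s i := hs0 ▸ hmono (Nat.zero_le i)
    have hup : s (i + 1) ≤ b := hsM ▸ hmono (Finset.mem_range.1 hi)
    have hrm : r ∈ Set.Icc a b := ⟨hlow.trans hr.1.le, hr.2.trans hup⟩
    rw [← mul_sub, norm_mul]
    refine mul_le_mul (hB r hrm) ?_ (norm_nonneg _) hB0
    rw [← dist_eq_norm]
    refine (hFδ _ ⟨hlow.trans hle', hup⟩ r hrm ?_).le
    rw [Real.dist_eq, abs_of_nonneg (sub_nonneg.2 hr.2)]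
    have := hstep i
    linarith [hr.1]
  calc _ ≤ ∑ i ∈ Finset.range (m + 1), B * η * (s (i + 1) - s i) := norm_sum_le_of_le _ hle
    _ = B * (b - a) * η := by
        rw [← Finset.mul_sum, Finset.sum_range_sub, hs0, hsM]; ring
    _ < (B * (b - a) + 1) * η := by linarith
    _ = ε := by rw [hη]; field_simp

/-! ### Second moments of sums, recursions and limits -/

section SecondMoments

variable {Ω : Type*} {mΩ : MeasurableSpace Ω} {P : Measure Ω}

lemma integral_sum_mul_sum_nonpos {ι κ : Type*} {s : Finset ι} {t : Finset κ} {p : ι → ℝ}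
    {q : κ → ℝ} {Y : ι → Ω → ℝ} {Z : κ → Ω → ℝ} (hp : ∀ i ∈ s, 0 ≤ p i) (hq : ∀ j ∈ t, 0 ≤ q j)
    (hY : ∀ i, MemLp (Y i) 2 P) (hZ : ∀ j, MemLp (Z j) 2 P)
    (hYZ : ∀ i ∈ s, ∀ j ∈ t, ∫ ω, Y i ω * Z j ω ∂P ≤ 0) :
    ∫ ω, (∑ i ∈ s, p i * Y i ω) * (∑ j ∈ t, q j * Z j ω) ∂P ≤ 0 := by
  have hint : ∀ i j, Integrable (fun ω => p i * q j * (Y i ω * Z j ω)) P :=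
    fun i j => ((hY i).integrable_mul (hZ j)).const_mul _
  have h : ∀ ω, (∑ i ∈ s, p i * Y i ω) * (∑ j ∈ t, q j * Z j ω) =
      ∑ i ∈ s, ∑ j ∈ t, p i * q j * (Y i ω * Z j ω) := by
    intro ω
    rw [Finset.sum_mul_sum]
    exact Finset.sum_congr rfl fun i _ => Finset.sum_congr rfl fun j _ => by ring
  simp_rw [h]
  rw [integral_finsetSum _ fun i _ => integrable_finsetSum _ fun j _ => hint i j]
  refine Finset.sum_nonpos fun i hi => ?_
  rw [integral_finsetSum _ fun j _ => hint i j]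
  refine Finset.sum_nonpos fun j hj => ?_
  rw [integral_const_mul]
  exact mul_nonpos_of_nonneg_of_nonpos (mul_nonneg (hp i hi) (hq j hj)) (hYZ i hi j hj)

lemma memLp_sum_const_mul {ι : Type*} (s : Finset ι) (p : ι → ℝ) {Y : ι → Ω → ℝ}
    (hY : ∀ i, MemLp (Y i) 2 P) : MemLp (fun ω => ∑ i ∈ s, p i * Y i ω) 2 P :=
  memLp_finsetSum s fun i _ => (hY i).const_mul (p i)

/-- Cauchy-Schwarz with respect to the weights `p`, applied pointwise and then integrated. -/
lemma integral_sq_sum_le {ι : Type*} {s : Finset ι} {p : ι → ℝ} {Y : ι → Ω → ℝ}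
    (hp : ∀ i ∈ s, 0 ≤ p i) (hY : ∀ i, MemLp (Y i) 2 P) :
    ∫ ω, (∑ i ∈ s, p i * Y i ω) ^ 2 ∂P ≤ (∑ i ∈ s, p i) * ∑ i ∈ s, p i * ∫ ω, Y i ω ^ 2 ∂P := by
  have hint : ∀ i, Integrable (fun ω => p i * Y i ω ^ 2) P :=
    fun i => (hY i).integrable_sq.const_mul _
  have hr : (∑ i ∈ s, p i) * ∑ i ∈ s, p i * ∫ ω, Y i ω ^ 2 ∂P =
      ∫ ω, (∑ i ∈ s, p i) * ∑ i ∈ s, p i * Y i ω ^ 2 ∂P := by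
    rw [integral_const_mul, integral_finsetSum _ fun i _ => hint i]
    simp_rw [integral_const_mul]
  rw [hr]
  refine integral_mono (memLp_sum_const_mul s p hY).integrable_sq
    ((integrable_finsetSum _ fun i _ => hint i).const_mul _) fun ω => ?_
  exact Finset.sum_sq_le_sum_mul_sum_of_sq_le_mul s hp
    (fun i hi => mul_nonneg (hp i hi) (sq_nonneg _)) fun i _ => le_of_eq (by ring)

/-- A linear recursion driven by negatively correlated noise of second moment at most
`(1 - q) * B` has second moment at most `B`. -/
lemma integral_sq_recursion_le {q B : ℝ} (hq0 : 0 ≤ q) (hq1 : q ≤ 1) (hB : 0 ≤ B)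
    {V A : ℕ → Ω → ℝ} (hV : ∀ k, MemLp (V k) 2 P)
    (hneg : ∀ i j, i < j → ∫ ω, V i ω * V j ω ∂P ≤ 0)
    (hsq : ∀ k, ∫ ω, V k ω ^ 2 ∂P ≤ (1 - q) * B)
    (hA0 : A 0 = 0) (hA : ∀ n, A (n + 1) = fun ω => q * A n ω + V n ω) (n : ℕ) :
    MemLp (A n) 2 P ∧ ∫ ω, A n ω ^ 2 ∂P ≤ B := by
  -- The induction also has to carry the nonpositive correlation of `A n` with all noise not yet
  -- used.
  suffices h : MemLp (A n) 2 P ∧ ∫ ω, A n ω ^ 2 ∂P ≤ B ∧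
      ∀ j, n ≤ j → ∫ ω, A n ω * V j ω ∂P ≤ 0 from ⟨h.1, h.2.1⟩
  induction n with
  | zero => simp [hA0, hB]
  | succ n ih =>
    obtain ⟨h1, h2, h3⟩ := ih
    rw [hA]
    have hAV : ∀ j, Integrable (fun ω => A n ω * V j ω) P := fun j => h1.integrable_mul (hV j)
    refine ⟨(h1.const_mul q).add (hV n), ?_, fun j hj => ?_⟩
    · have e : ∀ ω, (q * A n ω + V n ω) ^ 2 =
          q ^ 2 * A n ω ^ 2 + 2 * q * (A n ω * V n ω) + V n ω ^ 2 := fun ω => by ring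
      simp_rw [e]
      have i1 : Integrable (fun ω => q ^ 2 * A n ω ^ 2) P := h1.integrable_sq.const_mul _
      have i2 : Integrable (fun ω => 2 * q * (A n ω * V n ω)) P := (hAV n).const_mul _
      have i3 : Integrable (fun ω => q ^ 2 * A n ω ^ 2 + 2 * q * (A n ω * V n ω)) P := i1.add i2
      rw [integral_add i3 (hV n).integrable_sq, integral_add i1 i2, integral_const_mul,
        integral_const_mul]
      have h4 : q ^ 2 * ∫ ω, A n ω ^ 2 ∂P ≤ q * B := by
        have : q ^ 2 ≤ q := by nlinarith
        exact mul_le_mul this h2 (integral_nonneg fun _ => sq_nonneg _) hq0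
      have h5 : 2 * q * ∫ ω, A n ω * V n ω ∂P ≤ 0 :=
        mul_nonpos_of_nonneg_of_nonpos (by positivity) (h3 n le_rfl)
      linarith [hsq n]
    · have e : ∀ ω, (q * A n ω + V n ω) * V j ω = q * (A n ω * V j ω) + V n ω * V j ω :=
        fun ω => by ring
      simp_rw [e]
      have i1 : Integrable (fun ω => V n ω * V j ω) P := (hV n).integrable_mul (hV j)
      rw [integral_add ((hAV j).const_mul _) i1, integral_const_mul]
      have := mul_nonpos_of_nonneg_of_nonpos hq0 (h3 j (by omega))
      linarith [hneg n j (by omega)]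

/-- Fatou's lemma for the squares. -/
lemma memLp_two_of_tendsto_ae {B : ℝ} {f : ℕ → Ω → ℝ} {g : Ω → ℝ}
    (hf : ∀ m, MemLp (f m) 2 P) (hB : ∀ m, ∫ ω, f m ω ^ 2 ∂P ≤ B)
    (hfg : ∀ᵐ ω ∂P, Tendsto (fun m => f m ω) atTop (𝓝 (g ω))) :
    MemLp g 2 P ∧ ∫ ω, g ω ^ 2 ∂P ≤ B := by
  have hB0 : 0 ≤ B := (integral_nonneg fun _ => sq_nonneg _).trans (hB 0)
  have hg : AEStronglyMeasurable g P := aestronglyMeasurable_of_tendsto_ae _ (fun m => (hf m).1) hfg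
  have key : ∫⁻ ω, ENNReal.ofReal (g ω ^ 2) ∂P ≤ ENNReal.ofReal B := by
    calc _ = ∫⁻ ω, liminf (fun m => ENNReal.ofReal (f m ω ^ 2)) atTop ∂P := by
          refine lintegral_congr_ae (hfg.mono fun ω hω => ?_)
          exact (((ENNReal.continuous_ofReal.tendsto _).comp (hω.pow 2)).liminf_eq).symm
      _ ≤ liminf (fun m => ∫⁻ ω, ENNReal.ofReal (f m ω ^ 2) ∂P) atTop :=
          lintegral_liminf_le' fun m => ((hf m).1.aemeasurable.pow_const 2).ennreal_ofReal
      _ ≤ liminf (fun _ : ℕ => ENNReal.ofReal B) atTop := by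
          refine liminf_le_liminf (Eventually.of_forall fun m => ?_)
          rw [← ofReal_integral_eq_lintegral_ofReal (hf m).integrable_sq
            (Eventually.of_forall fun _ => sq_nonneg _)]
          exact ENNReal.ofReal_le_ofReal (hB m)
      _ = ENNReal.ofReal B := liminf_const _
  refine ⟨(memLp_two_iff_integrable_sq hg).2 ⟨hg.pow 2, ?_⟩, ?_⟩
  · rw [hasFiniteIntegral_iff_ofReal (Eventually.of_forall fun _ => sq_nonneg _)]
    exact key.trans_lt ENNReal.ofReal_lt_top
  · rw [integral_eq_lintegral_of_nonneg_ae (Eventually.of_forall fun _ => sq_nonneg _) (hg.pow 2)]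
    exact ENNReal.toReal_le_of_le_ofReal hB0 key

end SecondMoments


/-! ### Increments of fractional Brownian motion and the discretized errors -/

section FractionalBrownianMotion

variable {Ω : Type*} {mΩ : MeasurableSpace Ω} {P : Measure Ω} {H : ℝ} {β : ℝ≥0 → Ω → ℝ}

lemma IsFractionalBrownianMotion.memLp_two (hβ : IsFractionalBrownianMotion H β P) (t : ℝ≥0) :
    MemLp (β t) 2 P :=
  (hβ.isGaussianProcess.hasGaussianLaw_eval t).memLp_two

lemma IsFractionalBrownianMotion.integral_increment_mul (hβ : IsFractionalBrownianMotion H β P)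
    {a b c d : ℝ} (ha : 0 ≤ a) (hb : 0 ≤ b) (hc : 0 ≤ c) (hd : 0 ≤ d) :
    ∫ ω, (β b.toNNReal ω - β a.toNNReal ω) * (β d.toNNReal ω - β c.toNNReal ω) ∂P =
      1 / 2 * (|a - d| ^ (2 * H) + |b - c| ^ (2 * H) - |b - d| ^ (2 * H) - |a - c| ^ (2 * H)) := by
  have hint : ∀ t s, Integrable (fun ω => β t ω * β s ω) P :=
    fun t s => (hβ.memLp_two t).integrable_mul (hβ.memLp_two s)
  have e : ∀ ω, (β b.toNNReal ω - β a.toNNReal ω) * (β d.toNNReal ω - β c.toNNReal ω) =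
      (β b.toNNReal ω * β d.toNNReal ω - β b.toNNReal ω * β c.toNNReal ω) -
      (β a.toNNReal ω * β d.toNNReal ω - β a.toNNReal ω * β c.toNNReal ω) := fun ω => by ring
  simp_rw [e]
  rw [integral_sub (by exact (hint _ _).sub (hint _ _)) (by exact (hint _ _).sub (hint _ _)),
    integral_sub (hint _ _) (hint _ _), integral_sub (hint _ _) (hint _ _)]
  simp only [hβ.covariance_eq, Real.coe_toNNReal _ ha, Real.coe_toNNReal _ hb,
    Real.coe_toNNReal _ hc, Real.coe_toNNReal _ hd]
  ring

lemma IsFractionalBrownianMotion.integral_increment_sq (hβ : IsFractionalBrownianMotion H β P)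
    (hH : 0 < H) {a b : ℝ} (ha : 0 ≤ a) (hab : a ≤ b) :
    ∫ ω, (β b.toNNReal ω - β a.toNNReal ω) ^ 2 ∂P = (b - a) ^ (2 * H) := by
  have hb := ha.trans hab
  simp_rw [pow_two]
  rw [hβ.integral_increment_mul ha hb ha hb, abs_sub_comm a b, abs_of_nonneg (sub_nonneg.2 hab)]
  simp only [sub_self, abs_zero, Real.zero_rpow (mul_pos two_pos hH).ne']
  ring

/-- For `H ≤ 1 / 2`, increments over disjoint intervals are nonpositively correlated. -/
lemma IsFractionalBrownianMotion.integral_increment_mul_nonpos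
    (hβ : IsFractionalBrownianMotion H β P) (hH0 : 0 ≤ H) (hH1 : H ≤ 1 / 2) {a b c d : ℝ}
    (ha : 0 ≤ a) (hab : a ≤ b) (hbc : b ≤ c) (hcd : c ≤ d) :
    ∫ ω, (β b.toNNReal ω - β a.toNNReal ω) * (β d.toNNReal ω - β c.toNNReal ω) ∂P ≤ 0 := by
  rw [hβ.integral_increment_mul ha (ha.trans hab) (ha.trans (hab.trans hbc))
    (ha.trans (hab.trans (hbc.trans hcd))), abs_sub_comm a d, abs_sub_comm b c,
    abs_sub_comm b d, abs_sub_comm a c, abs_of_nonneg (by linarith : 0 ≤ d - a),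
    abs_of_nonneg (by linarith : 0 ≤ c - b), abs_of_nonneg (by linarith : 0 ≤ d - b),
    abs_of_nonneg (by linarith : 0 ≤ c - a)]
  have h := rpow_add_add_rpow_le (γ := 2 * H) (by linarith) (by linarith) (sub_nonneg.2 hbc)
    (sub_nonneg.2 hab) (sub_nonneg.2 hcd)
  rw [show c - b + (b - a) + (d - c) = d - a by ring, show c - b + (b - a) = c - a by ring,
    show c - b + (d - c) = d - b by ring] at h
  linarith

/-- Needed to start the recursion: the Ornstein-Uhlenbeck process at time `0` equals `β 0`, while
the scheme starts from `0`. -/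
lemma IsFractionalBrownianMotion.ae_eq_zero (hβ : IsFractionalBrownianMotion H β P)
    (hH : 0 < H) : ∀ᵐ ω ∂P, β 0 ω = 0 := by
  have h : ∫ ω, β 0 ω ^ 2 ∂P = 0 := by
    simp_rw [pow_two]
    rw [hβ.covariance_eq]
    simp [Real.zero_rpow (mul_pos two_pos hH).ne']
  rw [integral_eq_zero_iff_of_nonneg (fun _ => sq_nonneg _) (hβ.memLp_two 0).integrable_sq] at h
  exact h.mono fun ω hω => by simpa using hω

/-- The Riemann sum, on a partition into `m + 1` pieces, of the local error of the scheme on the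
`k`-th time step. -/
noncomputable def localErrorSum (β : ℝ≥0 → Ω → ℝ) (lam dt : ℝ) (m k : ℕ) (ω : Ω) : ℝ :=
  ∑ i ∈ Finset.range (m + 1),
    (Real.exp (-(lam * dt * (1 - ((i + 1 : ℕ) : ℝ) / (m + 1)))) -
      Real.exp (-(lam * dt * (1 - (i : ℝ) / (m + 1))))) *
    (β ((k + 1) * dt : ℝ).toNNReal ω -
      β (k * dt + dt * (((i + 1 : ℕ) : ℝ) / (m + 1)) : ℝ).toNNReal ω)

/-- The Riemann sum of the global error of the scheme. -/
noncomputable def globalErrorSum (β : ℝ≥0 → Ω → ℝ) (lam dt : ℝ) (m : ℕ) : ℕ → Ω → ℝ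
  | 0 => 0
  | n + 1 => fun ω =>
      Real.exp (-(lam * dt)) * globalErrorSum β lam dt m n ω + localErrorSum β lam dt m n ω

lemma antitone_mul_one_sub_div {x : ℝ} (hx : 0 ≤ x) (m : ℕ) :
    Antitone fun i : ℕ => x * (1 - (i : ℝ) / (m + 1)) := by
  intro i j hij
  have : (i : ℝ) ≤ j := by exact_mod_cast hij
  dsimp only
  gcongr

lemma exp_sub_exp_partition_nonneg {x : ℝ} (hx : 0 ≤ x) (m i : ℕ) :
    0 ≤ Real.exp (-(x * (1 - ((i + 1 : ℕ) : ℝ) / (m + 1)))) -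
      Real.exp (-(x * (1 - (i : ℝ) / (m + 1)))) :=
  sub_nonneg.2 (Real.exp_le_exp.2 (neg_le_neg (antitone_mul_one_sub_div hx m i.le_succ)))

lemma partition_mem_Icc {dt : ℝ} (hdt : 0 ≤ dt) (k : ℕ) {m i : ℕ} (hi : i ∈ Finset.range (m + 1)) :
    (k * dt + dt * (((i + 1 : ℕ) : ℝ) / (m + 1)) : ℝ) ∈ Set.Icc (k * dt : ℝ) ((k + 1) * dt) := by
  have h1 : ((i + 1 : ℕ) : ℝ) / (m + 1) ≤ 1 := by
    rw [div_le_one (by positivity)]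
    exact_mod_cast Finset.mem_range.1 hi
  refine ⟨le_add_of_nonneg_right (by positivity), ?_⟩
  nlinarith

lemma IsFractionalBrownianMotion.memLp_increment (hβ : IsFractionalBrownianMotion H β P)
    (s t : ℝ≥0) : MemLp (fun ω => β t ω - β s ω) 2 P :=
  (hβ.memLp_two t).sub (hβ.memLp_two s)

lemma IsFractionalBrownianMotion.memLp_localErrorSum (hβ : IsFractionalBrownianMotion H β P)
    (lam dt : ℝ) (m k : ℕ) : MemLp (localErrorSum β lam dt m k) 2 P :=
  memLp_sum_const_mul _ _ fun _ => hβ.memLp_increment _ _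

lemma IsFractionalBrownianMotion.integral_localErrorSum_mul_nonpos
    (hβ : IsFractionalBrownianMotion H β P) (hH0 : 0 ≤ H) (hH1 : H ≤ 1 / 2) {lam dt : ℝ}
    (hlam : 0 ≤ lam) (hdt : 0 ≤ dt) (m : ℕ) {k j : ℕ} (hkj : k < j) :
    ∫ ω, localErrorSum β lam dt m k ω * localErrorSum β lam dt m j ω ∂P ≤ 0 := by
  have hx : 0 ≤ lam * dt := mul_nonneg hlam hdt
  refine integral_sum_mul_sum_nonpos (fun i _ => exp_sub_exp_partition_nonneg hx m i)
    (fun i _ => exp_sub_exp_partition_nonneg hx m i) (fun _ => hβ.memLp_increment _ _)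
    (fun _ => hβ.memLp_increment _ _) fun i hi l hl => ?_
  have hi' := partition_mem_Icc hdt k hi
  have hl' := partition_mem_Icc hdt j hl
  have hkj' : (k : ℝ) + 1 ≤ j := by exact_mod_cast hkj
  refine hβ.integral_increment_mul_nonpos hH0 hH1 (le_trans (by positivity) hi'.1) hi'.2 ?_ hl'.2
  exact (mul_le_mul_of_nonneg_right hkj' hdt).trans hl'.1

/-- The exact exponential weights telescope to `1 - exp (-(lam * dt))` for every `m`, which is
precisely the factor that `integral_sq_recursion_le` absorbs. -/
lemma IsFractionalBrownianMotion.integral_localErrorSum_sq_le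
    (hβ : IsFractionalBrownianMotion H β P) (hH0 : 0 < H) (hH1 : H ≤ 1 / 2) {lam dt δ : ℝ}
    (hlam : 0 < lam) (hdt : 0 < dt) (hδ0 : 0 ≤ δ) (hδ : δ ≤ 2 * H + 1) (m k : ℕ) :
    ∫ ω, localErrorSum β lam dt m k ω ^ 2 ∂P ≤
      (1 - Real.exp (-(lam * dt))) * (2 * lam ^ (-(2 * H)) * (lam * dt) ^ δ) := by
  have hx : 0 < lam * dt := mul_pos hlam hdt
  set v : ℕ → ℝ := fun i => lam * dt * (1 - (i : ℝ) / (m + 1)) with hv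
  have hv0 : v 0 = lam * dt := by simp [hv]
  have hvM : v (m + 1) = 0 := by
    simp only [hv]
    push_cast
    rw [div_self (by positivity), sub_self, mul_zero]
  have hanti : Antitone v := antitone_mul_one_sub_div hx.le m
  refine (integral_sq_sum_le (fun i _ => exp_sub_exp_partition_nonneg hx.le m i)
    (fun _ => hβ.memLp_increment _ _)).trans ?_
  change (∑ i ∈ Finset.range (m + 1), (Real.exp (-v (i + 1)) - Real.exp (-v i))) *
    ∑ i ∈ Finset.range (m + 1), (Real.exp (-v (i + 1)) - Real.exp (-v i)) * _ ≤ _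
  rw [Finset.sum_range_sub fun i => Real.exp (-v i), hvM, hv0, neg_zero, Real.exp_zero]
  refine mul_le_mul_of_nonneg_left ?_
    (sub_nonneg.2 (Real.exp_le_one_iff.2 (neg_nonpos.2 hx.le)))
  have hsum := sum_exp_neg_mul_rpow_le_two_mul_rpow (γ := 2 * H) (by linarith) (by linarith)
    hδ0 hδ hanti hvM (hv0 ▸ hx)
  rw [hv0] at hsum
  calc _ = lam ^ (-(2 * H)) * ∑ i ∈ Finset.range (m + 1),
        (Real.exp (-v (i + 1)) - Real.exp (-v i)) * v (i + 1) ^ (2 * H) := by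
        rw [Finset.mul_sum]
        refine Finset.sum_congr rfl fun i hi => ?_
        have hi' := partition_mem_Icc hdt.le k hi
        have hvi : 0 ≤ v (i + 1) := hvM ▸ hanti (Finset.mem_range.1 hi)
        -- Rescaling time by `lam` turns `(t_{k+1} - s) ^ (2H)` into `lam ^ (-2H) * v ^ (2H)`.
        have e : ((k + 1) * dt : ℝ) - (k * dt + dt * (((i + 1 : ℕ) : ℝ) / (m + 1))) =
            lam⁻¹ * v (i + 1) := by
          simp only [hv]
          field_simp
          ring
        rw [hβ.integral_increment_sq hH0 (le_trans (by positivity) hi'.1) hi'.2, e,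
          Real.mul_rpow (by positivity) hvi, Real.inv_rpow hlam.le, ← Real.rpow_neg hlam.le]
        ring
    _ ≤ lam ^ (-(2 * H)) * (2 * (lam * dt) ^ δ) :=
        mul_le_mul_of_nonneg_left hsum (Real.rpow_nonneg hlam.le _)
    _ = _ := by ring

lemma IsFractionalBrownianMotion.globalErrorSum_bound
    (hβ : IsFractionalBrownianMotion H β P) (hH0 : 0 < H) (hH1 : H ≤ 1 / 2) {lam dt δ : ℝ}
    (hlam : 0 < lam) (hdt : 0 < dt) (hδ0 : 0 ≤ δ) (hδ : δ ≤ 2 * H + 1) (m n : ℕ) :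
    MemLp (globalErrorSum β lam dt m n) 2 P ∧
      ∫ ω, globalErrorSum β lam dt m n ω ^ 2 ∂P ≤ 2 * lam ^ (-(2 * H)) * (lam * dt) ^ δ :=
  integral_sq_recursion_le (Real.exp_nonneg _)
    (Real.exp_le_one_iff.2 (neg_nonpos.2 (mul_pos hlam hdt).le)) (by positivity)
    (hβ.memLp_localErrorSum lam dt m)
    (fun _ _ hij => hβ.integral_localErrorSum_mul_nonpos hH0.le hH1 hlam.le hdt.le m hij)
    (hβ.integral_localErrorSum_sq_le hH0 hH1 hlam hdt hδ0 hδ m) rfl (fun _ => rfl) n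

end FractionalBrownianMotion

/-! ### Pathwise error recursion and convergence of the Riemann sums -/

section Pathwise

variable {Ω : Type*} {β : ℝ≥0 → Ω → ℝ} {ω : Ω}

lemma hasDerivAt_exp_neg_mul_sub (lam t s : ℝ) :
    HasDerivAt (fun s => Real.exp (-lam * (t - s))) (lam * Real.exp (-lam * (t - s))) s := by
  have h := (((hasDerivAt_id s).const_sub t).const_mul (-lam)).exp
  convert! h using 1
  simp only [id]
  ring

lemma tendsto_localErrorSum (hω : Continuous fun t => β t ω) (lam : ℝ) {dt : ℝ} (hdt : 0 ≤ dt)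
    (k : ℕ) :
    Tendsto (fun m => localErrorSum β lam dt m k ω) atTop
      (𝓝 (∫ s in (k * dt : ℝ)..((k + 1) * dt), lam * Real.exp (-lam * ((k + 1) * dt - s)) *
        (β ((k + 1) * dt : ℝ).toNNReal ω - β s.toNNReal ω))) := by
  have hF : Continuous fun s : ℝ => β ((k + 1) * dt : ℝ).toNNReal ω - β s.toNNReal ω :=
    continuous_const.sub (hω.comp continuous_real_toNNReal)
  have h := tendsto_sum_sub_mul_integral (hasDerivAt_exp_neg_mul_sub lam ((k + 1) * dt))
    (by fun_prop) hF (by nlinarith : (k * dt : ℝ) ≤ (k + 1) * dt)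
  refine h.congr fun m => Finset.sum_congr rfl fun i _ => ?_
  have e : ((k + 1) * dt - k * dt : ℝ) = dt := by ring
  rw [e]
  congr 3 <;> ring_nf

lemma fractionalOU_eq (lam : ℝ) (t : ℝ≥0) :
    fractionalOU β lam t ω = β t ω -
      ∫ s in (0 : ℝ)..t, lam * Real.exp (-lam * (t - s)) * β s.toNNReal ω := by
  simp only [fractionalOU, fbmIntegral, (hasDerivAt_exp_neg_mul_sub lam t _).deriv, sub_self,
    mul_zero, Real.exp_zero, one_mul]

/-- The recursion for the global error in terms of the local errors. -/
lemma fractionalOU_sub_schemeOU_succ (hω : Continuous fun t => β t ω) (lam : ℝ) (dt : ℝ≥0)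
    (n : ℕ) :
    fractionalOU β lam (((n + 1 : ℕ) : ℝ≥0) * dt) ω - schemeOU β lam dt (n + 1) ω =
      Real.exp (-(lam * dt)) *
        (fractionalOU β lam ((n : ℝ≥0) * dt) ω - schemeOU β lam dt n ω) +
      ∫ s in (n * dt : ℝ)..((n + 1) * dt), lam * Real.exp (-lam * ((n + 1) * dt - s)) *
        (β ((n + 1) * dt : ℝ).toNNReal ω - β s.toNNReal ω) := by
  have hN : ((n + 1) * dt : ℝ).toNNReal = ((n + 1 : ℕ) : ℝ≥0) * dt := by
    rw [← NNReal.coe_inj, Real.coe_toNNReal _ (by positivity)]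
    push_cast
    ring
  rw [fractionalOU_eq, fractionalOU_eq, hN]
  simp only [schemeOU, NNReal.coe_mul, NNReal.coe_natCast, NNReal.coe_add, NNReal.coe_one,
    Nat.cast_add, Nat.cast_one]
  set t : ℝ := n * dt with ht
  set T : ℝ := (n + 1) * dt with hT
  set bT := β ((n + 1) * dt) ω
  set bt := β (n * dt) ω
  have hc : Continuous fun s => lam * Real.exp (-lam * (T - s)) * β s.toNNReal ω := by fun_prop
  have hw : Continuous fun s => lam * Real.exp (-lam * (T - s)) := by fun_prop
  have hsplit := intervalIntegral.integral_add_adjacent_intervals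
    (hc.intervalIntegrable (μ := volume) 0 t) (hc.intervalIntegrable t T)
  have hfirst : ∫ s in (0 : ℝ)..t, lam * Real.exp (-lam * (T - s)) * β s.toNNReal ω =
      Real.exp (-(lam * dt)) * ∫ s in (0 : ℝ)..t, lam * Real.exp (-lam * (t - s)) *
        β s.toNNReal ω := by
    rw [← intervalIntegral.integral_const_mul]
    congr 1
    ext s
    rw [show -lam * (T - s) = -(lam * dt) + -lam * (t - s) by rw [hT, ht]; ring, Real.exp_add]
    ring
  -- The term `bT` is the boundary term of the integral up to `T`, and `-exp (-(lam * dt)) * bT`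
  -- comes from the increment in the scheme.
  have hlocal : ∫ s in t..T, lam * Real.exp (-lam * (T - s)) * (bT - β s.toNNReal ω) =
      (1 - Real.exp (-(lam * dt))) * bT -
        ∫ s in t..T, lam * Real.exp (-lam * (T - s)) * β s.toNNReal ω := by
    simp_rw [mul_sub (lam * _)]
    have hcT : Continuous fun s => lam * Real.exp (-lam * (T - s)) * bT := hw.mul continuous_const
    rw [intervalIntegral.integral_sub (hcT.intervalIntegrable _ _)
      (hc.intervalIntegrable _ _), intervalIntegral.integral_mul_const,
      intervalIntegral.integral_eq_sub_of_hasDerivAt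
        (fun s _ => hasDerivAt_exp_neg_mul_sub lam T s) (hw.intervalIntegrable _ _),
      show -lam * (T - t) = -(lam * dt) by rw [hT, ht]; ring, sub_self, mul_zero, Real.exp_zero]
  rw [hlocal, ← hsplit, hfirst, neg_mul]
  ring

lemma tendsto_globalErrorSum (hω : Continuous fun t => β t ω) (h0 : β 0 ω = 0) (lam : ℝ)
    (dt : ℝ≥0) (n : ℕ) :
    Tendsto (fun m => globalErrorSum β lam dt m n ω) atTop
      (𝓝 (fractionalOU β lam ((n : ℝ≥0) * dt) ω - schemeOU β lam dt n ω)) := by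
  induction n with
  | zero => simp [fractionalOU_eq, schemeOU, globalErrorSum, h0]
  | succ n ih =>
    rw [fractionalOU_sub_schemeOU_succ hω]
    exact (ih.const_mul _).add (tendsto_localErrorSum hω lam dt.2 n)

end Pathwise

theorem mainTheorem10 (H : ℝ) (hH0 : 0 < H) (hH1 : H < 1 / 2)
    (α : ℝ) (hα0 : 0 ≤ α) (hα1 : α < 2 * H) :
    ∃ C : ℝ, 0 < C ∧
      ∀ (Ω : Type*) (mΩ : MeasurableSpace Ω) (P : Measure Ω) (_ : IsProbabilityMeasure P)
        (β : ℝ≥0 → Ω → ℝ), IsFractionalBrownianMotion H β P →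
        ∀ lam : ℝ, 0 < lam → ∀ dt : ℝ≥0, 0 < dt → dt < 1 → ∀ n : ℕ,
          MemLp (fun ω => fractionalOU β lam ((n : ℝ≥0) * dt) ω - schemeOU β lam dt n ω) 2 P ∧
          ∫ ω, |fractionalOU β lam ((n : ℝ≥0) * dt) ω - schemeOU β lam dt n ω| ^ 2 ∂P
            ≤ C * lam ^ (-(2 * H)) * (lam * (dt : ℝ)) ^ (2 * α) := by
  refine ⟨2, two_pos, fun Ω mΩ P _ β hβ lam hlam dt hdt _ n => ?_⟩
  simp_rw [sq_abs]
  -- The choice `δ = 2 * α` is admissible: `2 * α < 4 * H < 2 * H + 1`, by `α < 2 * H` and `H < 1 /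
  -- 2`.
  have hbound := fun m => hβ.globalErrorSum_bound hH0 hH1.le hlam (dt := (dt : ℝ)) (δ := 2 * α)
    (by exact_mod_cast hdt) (by linarith) (by linarith) m n
  refine memLp_two_of_tendsto_ae (fun m => (hbound m).1) (fun m => (hbound m).2) ?_
  filter_upwards [hβ.ae_continuous, hβ.ae_eq_zero hH0] with ω hω h0
  exact tendsto_globalErrorSum hω h0 lam dt n
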